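/- All categories and functors are additive (an additive category is a preadditive category with all finite direct sums, including a zero object). For an additive category $B$ let $\mathrm{Kar}(B)$ be its idempotent completion: its objects are the pairs $(X,p)$ with $X\in B$, $p\colon X\to X$, $p^2=p$, and a morphism $(X,p)\to(X',p')$ is an $f\in B(X,X')$ with $p'f=fp=f$. Let $\mathrm{Wkar}(B)$ be the full subcategory of $\mathrm{Kar}(B)$ whose objects are those $Z$ for which there exist $X,Y\in B$ with $(X,\mathrm{id}_X)\oplus Z\cong (Y,\mathrm{id}_Y)$ in $\mathrm{Kar}(B)$; the assignment $X\mapsto (X,\mathrm{id}_X)$ defines the canonical embedding $B\to \mathrm{Wkar}(B)$. Let $K^b(B)$ be the homotopy category of bounded complexes over $B$. For an essentially small $B$ the split Grothendieck group $K_0^{\mathrm{add}}(B)$ is the abelian group generated by the isomorphism classes of objects of $B$, with the relations $[Y]=[X]+[Z]$ whenever $Y\cong X\oplus Z$. Let $F\colon B\to B'$ be a fully faithful additive functor between additive categories (for example, the inclusion of a full additive subcategory $B\subset B'$). (1) The induced functor $K^b(B)\to K^b(B')$ is an equivalence of categories if and only if the canonical embedding $B\to \mathrm{Wkar}(B)$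 factors (up to isomorphism of functors) as $G\circ F$ for some fully faithful additive functor $G\colon B'\to \mathrm{Wkar}(B)$. (2) Consequently, if $B'$ is essentially small and the canonical embedding $B\to\mathrm{Wkar}(B)$ factors as in (1) (that is, $B\subset B'\subset \mathrm{Wkar}(B)$ via full embeddings), then the homomorphism $K_0^{\mathrm{add}}(B)\to K_0^{\mathrm{add}}(B')$, $[X]\mapsto[F(X)]$, is bijective. -/

import Mathlib

open CategoryTheory CategoryTheory.Limits CategoryTheory.Idempotents

universe w v₁ v₂ u₁ u₂

noncomputable section

namespace WeakIdem

attribute [local instance] hasBinaryBiproducts_of_finite_biproducts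

section Bounded

variable (C : Type u₁) [Category.{v₁} C] [Preadditive C]

/-- The property of objects in the homotopy category of cochain complexes (indexed by `ℤ`) over
`C` whose underlying complex is bounded: its terms are zero objects outside a finite interval. -/
def bounded : ObjectProperty (HomotopyCategory C (ComplexShape.up ℤ)) :=
  fun K => ∃ a b : ℤ, ∀ i : ℤ, (i < a ∨ b < i) → IsZero (K.as.X i)

/-- The bounded homotopy category `K^b(C)`: objects are bounded cochain complexes over `C`,
morphisms are morphisms of complexes up to chain homotopy. -/
abbrev BoundedHomotopyCategory := (bounded C).FullSubcategory

variable {C} {D : Type u₂} [Category.{v₂} D] [Preadditive D]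

/-- The functor `K^b(C) ⥤ K^b(D)` induced by an additive functor `F : C ⥤ D`, applying `F`
term by term. -/
def mapBoundedHomotopyCategory (F : C ⥤ D) [F.Additive] :
    BoundedHomotopyCategory C ⥤ BoundedHomotopyCategory D :=
  (bounded D).lift
    ((bounded C).ι ⋙ F.mapHomotopyCategory (ComplexShape.up ℤ))
    (fun K => by
      obtain ⟨a, b, h⟩ := K.property
      exact ⟨a, b, fun i hi => F.map_isZero (h i hi)⟩)

end Bounded

section WeakIdempotentCompletion

/-- The weak retraction-closure in `C` of a class `P` of objects: those `Z` such that
`X ⊞ Z ≅ Y` for some `X`, `Y` satisfying `P`. -/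
def weakRetractionClosure {C : Type u₁} [Category.{v₁} C] [Preadditive C] [HasFiniteBiproducts C]
    (P : ObjectProperty C) : ObjectProperty C :=
  fun Z => ∃ X Y : C, P X ∧ P Y ∧ Nonempty (X ⊞ Z ≅ Y)

variable (C : Type u₁) [Category.{v₁} C] [Preadditive C] [HasFiniteBiproducts C]

/-- The property defining the weak idempotent completion: the weak retraction-closure of (the
image `{(X, 𝟙 X)}` of) `C` in its idempotent completion `Karoubi C`. -/
def isWeakRetract : ObjectProperty (Karoubi C) :=
  weakRetractionClosure (ObjectProperty.ofObj (toKaroubi C).obj)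

/-- The weak idempotent completion of an additive category `C`, as a full subcategory of
the idempotent completion `Karoubi C`. -/
abbrev WeakIdempotentCompletion := (isWeakRetract C).FullSubcategory

lemma isWeakRetract_toKaroubi (X : C) : isWeakRetract C ((toKaroubi C).obj X) := by
  have := preservesBinaryBiproducts_of_preservesBiproducts (toKaroubi C)
  refine ⟨(toKaroubi C).obj X, (toKaroubi C).obj (X ⊞ X), ⟨_⟩, ⟨_⟩, ⟨?_⟩⟩
  exact ((toKaroubi C).mapBiprod X X).symm

/-- The canonical embedding of `C` into its weak idempotent completion, `X ↦ (X, 𝟙 X)`. -/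
def toWeakIdempotentCompletion : C ⥤ WeakIdempotentCompletion C :=
  (isWeakRetract C).lift (toKaroubi C) (isWeakRetract_toKaroubi C)

end WeakIdempotentCompletion

section SplitK0

variable (C : Type u₁) [Category.{v₁} C]

/-- The isomorphism classes of objects of `C`. -/
abbrev IsoClasses := Quotient (isIsomorphicSetoid C)

variable {C} in
/-- The isomorphism class of an object. -/
def isoClass (X : C) : IsoClasses C := Quotient.mk _ X

variable [Preadditive C] [HasFiniteBiproducts C]

/-- The subgroup of the free abelian group on isomorphism classes generated by the elements
`[Y] - [X] - [Z]` for `Y ≅ X ⊞ Z`. -/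
def splitRelations : AddSubgroup (FreeAbelianGroup (IsoClasses C)) :=
  AddSubgroup.closure
    { r | ∃ X Y Z : C, Nonempty (Y ≅ X ⊞ Z) ∧
      r = FreeAbelianGroup.of (isoClass Y) - FreeAbelianGroup.of (isoClass X)
        - FreeAbelianGroup.of (isoClass Z) }

/-- The split Grothendieck group `K_0^add(C)`. -/
abbrev SplitK0 := FreeAbelianGroup (IsoClasses C) ⧸ splitRelations C

variable {C} {D : Type u₂} [Category.{v₂} D]

/-- The map on isomorphism classes induced by a functor. -/
def mapIsoClasses (F : C ⥤ D) : IsoClasses C → IsoClasses D :=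
  Quotient.map F.obj (fun _ _ ⟨e⟩ => ⟨F.mapIso e⟩)

variable [Preadditive D] [HasFiniteBiproducts D]

/-- The homomorphism `K_0^add(C) → K_0^add(D)`, `[X] ↦ [F X]`, induced by an additive
functor `F`. -/
def mapSplitK0 (F : C ⥤ D) [F.Additive] : SplitK0 C →+ SplitK0 D :=
  QuotientAddGroup.map (splitRelations C) (splitRelations D)
    (FreeAbelianGroup.map (mapIsoClasses F)) (by
      rw [splitRelations, AddSubgroup.closure_le]
      rintro _ ⟨X, Y, Z, ⟨e⟩, rfl⟩
      refine AddSubgroup.subset_closure ⟨F.obj X, F.obj Y, F.obj Z, ⟨?_⟩, ?_⟩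
      · have := preservesBinaryBiproducts_of_preservesBiproducts F
        exact F.mapIso e ≪≫ F.mapBiprod X Z
      · simp only [map_sub, FreeAbelianGroup.map_of_apply]
        rfl)

end SplitK0

end WeakIdem

end

open WeakIdem

noncomputable section

namespace WeakIdem

attribute [local instance] hasBinaryBiproducts_of_finite_biproducts
attribute [local instance] preservesBinaryBiproducts_of_preservesBiproducts

/-! Both halves go through one condition, `IsWeaklyDense F`: each `X'` has a complement `F X` with
`F X ⊞ X' ≅ F Y`.

Such an isomorphism makes `X'` a retract of `F Y`, hence an idempotent of `Y` lying in the weak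
completion; conversely a fully faithful additive `G` reflects the complements that exist there. So
weak density is equivalent to the factorization.

Full faithfulness passes from `F` to `K^b`, so only essential surjectivity is at stake. If `F` is
weakly dense, adding a contractible complex with terms `F X` makes every term of a bounded complex
isomorphic to some `F Y` (`essSurj_mapBoundedHomotopyCategory`). Conversely, if `X'` in degree `0`
is equivalent to `F M`, transporting its identity gives an idempotent `e` of `M`, homotopic to `𝟙 M`
and living in degree `0`. Folding `M` into even and odd sums, the homotopy contracts everything but
the image of `e`, so that even ≅ odd ⊕ image of `e`, an Euler characteristic realized by an
isomorphism (`exists_of_homotopy_id`).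

On `K_0`, the inverse sends `[X']` to `[Y] - [X]`. -/

/-- A functor is weakly dense if every object `X'` of the target satisfies `F X ⊞ X' ≅ F Y`
for some `X` and `Y`. -/
def IsWeaklyDense {B : Type u₁} [Category.{v₁} B] {B' : Type u₂} [Category.{v₂} B']
    [Preadditive B'] [HasFiniteBiproducts B'] (F : B ⥤ B') : Prop :=
  ∀ X' : B', ∃ X Y : B, Nonempty (F.obj X ⊞ X' ≅ F.obj Y)

/-! ### Retracts of objects `F Y` as idempotents in the source -/

section Retract

variable {B : Type u₁} [Category.{v₁} B] {B' : Type u₂} [Category.{v₂} B']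
  {F : B ⥤ B'} [F.Full] [F.Faithful]

/-- A retract `X'` of `F Y`, viewed as an object of the Karoubi envelope. -/
abbrev karoubiOfRetract {X' : B'} {Y : B} (ρ : Retract X' (F.obj Y)) : Karoubi B where
  X := Y
  p := F.preimage (ρ.r ≫ ρ.i)
  idem := F.map_injective (by simp)

/-- The morphism in the Karoubi envelope induced by a morphism between retracts of `F Y`
and `F Y'`. -/
def karoubiHomOfRetract {X' X'' : B'} {Y Y' : B} (ρ : Retract X' (F.obj Y))
    (ρ' : Retract X'' (F.obj Y')) (f : X' ⟶ X'') : karoubiOfRetract ρ ⟶ karoubiOfRetract ρ' where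
  f := F.preimage (ρ.r ≫ f ≫ ρ'.i)
  comm := by
    change F.preimage _ ≫ F.preimage _ ≫ F.preimage _ = F.preimage _
    exact F.map_injective (by simp)

lemma map_karoubiHomOfRetract {X' X'' : B'} {Y Y' : B} (ρ : Retract X' (F.obj Y))
    (ρ' : Retract X'' (F.obj Y')) (f : X' ⟶ X'') :
    F.map (karoubiHomOfRetract ρ ρ' f).f = ρ.r ≫ f ≫ ρ'.i :=
  F.map_preimage _

lemma karoubiHomOfRetract_id {X' : B'} {Y : B} (ρ : Retract X' (F.obj Y)) :
    karoubiHomOfRetract ρ ρ (𝟙 X') = 𝟙 _ := by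
  ext
  change F.preimage _ = F.preimage _
  rw [Category.id_comp]

lemma karoubiHomOfRetract_comp {X₁ X₂ X₃ : B'} {Y₁ Y₂ Y₃ : B} (ρ₁ : Retract X₁ (F.obj Y₁))
    (ρ₂ : Retract X₂ (F.obj Y₂)) (ρ₃ : Retract X₃ (F.obj Y₃)) (f : X₁ ⟶ X₂) (g : X₂ ⟶ X₃) :
    karoubiHomOfRetract ρ₁ ρ₂ f ≫ karoubiHomOfRetract ρ₂ ρ₃ g =
      karoubiHomOfRetract ρ₁ ρ₃ (f ≫ g) := by
  ext
  change F.preimage _ ≫ F.preimage _ = F.preimage _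
  exact F.map_injective (by simp)

/-- The inverse is `f ↦ ρ.i ≫ F.map f.f ≫ ρ'.r`. This makes the functor to the Karoubi envelope
built from chosen retracts fully faithful. -/
lemma karoubiHomOfRetract_bijective {X' X'' : B'} {Y Y' : B} (ρ : Retract X' (F.obj Y))
    (ρ' : Retract X'' (F.obj Y')) : Function.Bijective (karoubiHomOfRetract ρ ρ') := by
  refine ⟨fun f g h => ?_, fun f => ⟨ρ.i ≫ F.map f.f ≫ ρ'.r, ?_⟩⟩
  · have h' := congrArg (fun m : karoubiOfRetract ρ ⟶ karoubiOfRetract ρ' =>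
      ρ.i ≫ F.map m.f ≫ ρ'.r) h
    rw [map_karoubiHomOfRetract, map_karoubiHomOfRetract] at h'
    simpa using h'
  · ext
    apply F.map_injective
    rw [map_karoubiHomOfRetract]
    obtain ⟨f, hf⟩ := f
    change F.preimage _ ≫ f ≫ F.preimage _ = f at hf
    have h := congrArg F.map hf
    rw [F.map_comp, F.map_comp, F.map_preimage, F.map_preimage] at h
    simpa only [Category.assoc] using h

/-- If a retract of `F Y` is of the form `F Z`, the corresponding object of the Karoubi envelope
is isomorphic to the image of `Z`. -/
def karoubiOfRetractIso {Z Y : B} (ρ : Retract (F.obj Z) (F.obj Y)) :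
    karoubiOfRetract ρ ≅ (toKaroubi B).obj Z where
  hom := ⟨F.preimage ρ.r, by
    change F.preimage _ ≫ F.preimage _ ≫ 𝟙 Z = F.preimage _
    exact F.map_injective (by simp)⟩
  inv := ⟨F.preimage ρ.i, by
    change 𝟙 Z ≫ F.preimage _ ≫ F.preimage _ = F.preimage _
    exact F.map_injective (by simp)⟩
  hom_inv_id := by
    ext
    change F.preimage _ ≫ F.preimage _ = F.preimage _
    exact F.map_injective (by simp)
  inv_hom_id := by
    ext
    change F.preimage _ ≫ F.preimage _ = 𝟙 Z
    exact F.map_injective (by simp)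

lemma karoubiOfRetractIso_hom_naturality {Z Z' Y Y' : B} (ρ : Retract (F.obj Z) (F.obj Y))
    (ρ' : Retract (F.obj Z') (F.obj Y')) (f : Z ⟶ Z') :
    karoubiHomOfRetract ρ ρ' (F.map f) ≫ (karoubiOfRetractIso ρ').hom =
      (karoubiOfRetractIso ρ).hom ≫ (toKaroubi B).map f := by
  ext
  change F.preimage _ ≫ F.preimage _ = F.preimage _ ≫ f
  exact F.map_injective (by simp)

variable [Preadditive B] [Preadditive B'] [F.Additive]

lemma karoubiHomOfRetract_add {X₁ X₂ : B'} {Y₁ Y₂ : B} (ρ₁ : Retract X₁ (F.obj Y₁))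
    (ρ₂ : Retract X₂ (F.obj Y₂)) (f g : X₁ ⟶ X₂) :
    karoubiHomOfRetract ρ₁ ρ₂ (f + g) =
      karoubiHomOfRetract ρ₁ ρ₂ f + karoubiHomOfRetract ρ₁ ρ₂ g := by
  ext
  change F.preimage _ = F.preimage _ + F.preimage _
  exact F.map_injective (by simp [F.map_add])

lemma karoubiHomOfRetract_zero {X₁ X₂ : B'} {Y₁ Y₂ : B} (ρ₁ : Retract X₁ (F.obj Y₁))
    (ρ₂ : Retract X₂ (F.obj Y₂)) :
    karoubiHomOfRetract ρ₁ ρ₂ 0 = 0 := by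
  ext
  change F.preimage _ = 0
  exact F.map_injective (by simp)

end Retract

variable {B : Type u₁} [Category.{v₁} B] [Preadditive B] [HasFiniteBiproducts B]
  {B' : Type u₂} [Category.{v₂} B'] [Preadditive B'] [HasFiniteBiproducts B']
  (F : B ⥤ B')

/-! ### Weak density and factorization through the weak idempotent completion -/

section Factorization

-- The complement of `G X'` is available in the Karoubi envelope between objects of `B`; the
-- composite `B' ⥤ Karoubi B` is additive and fully faithful, so it reflects that isomorphism.
variable {F} in
lemma isWeaklyDense_of_factorization (G : B' ⥤ WeakIdempotentCompletion B)
    (hG : G.Additive) [G.Full] [G.Faithful]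
    (e : F ⋙ G ≅ toWeakIdempotentCompletion B) : IsWeaklyDense F := by
  intro X'
  obtain ⟨X₁, Y₁, hX, hY, ⟨φ⟩⟩ := (G.obj X').property
  obtain ⟨X⟩ := hX
  obtain ⟨Y⟩ := hY
  let H : B' ⥤ Karoubi B := G ⋙ (isWeakRetract B).ι
  have : H.Additive := ⟨fun {_ _ f g} => congrArg (fun m => m.hom) (hG.map_add (f := f) (g := g))⟩
  let eH : ∀ Z : B, H.obj (F.obj Z) ≅ (toKaroubi B).obj Z :=
    fun Z => (isWeakRetract B).ι.mapIso (e.app Z)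
  exact ⟨X, Y, ⟨H.preimageIso (H.mapBiprod _ _ ≪≫ biprod.mapIso (eH X) (Iso.refl _) ≪≫ φ ≪≫
    (eH Y).symm)⟩⟩

variable [F.Additive] [F.Full] [F.Faithful]

variable {F} in
lemma isWeakRetract_karoubiOfRetract {X' : B'} {X Y : B} (φ : F.obj X ⊞ X' ≅ F.obj Y) :
    isWeakRetract B (karoubiOfRetract
      (⟨biprod.inr ≫ φ.hom, φ.inv ≫ biprod.snd, by simp⟩ : Retract X' (F.obj Y))) := by
  refine ⟨(toKaroubi B).obj X, (toKaroubi B).obj Y, ⟨X⟩, ⟨Y⟩, ⟨?_⟩⟩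
  let ρ : Retract X' (F.obj Y) := ⟨biprod.inr ≫ φ.hom, φ.inv ≫ biprod.snd, by simp⟩
  let σ : Retract (F.obj X) (F.obj X) := Retract.refl _
  let τ : Retract (F.obj Y) (F.obj Y) := Retract.refl _
  let e : karoubiOfRetract σ ⊞ karoubiOfRetract ρ ≅ karoubiOfRetract τ :=
    { hom := biprod.desc (karoubiHomOfRetract σ τ (biprod.inl ≫ φ.hom))
        (karoubiHomOfRetract ρ τ (biprod.inr ≫ φ.hom))
      inv := biprod.lift (karoubiHomOfRetract τ σ (φ.inv ≫ biprod.fst))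
        (karoubiHomOfRetract τ ρ (φ.inv ≫ biprod.snd))
      hom_inv_id := by
        apply biprod.hom_ext' <;> apply biprod.hom_ext <;>
          simp only [Category.assoc, biprod.inl_desc_assoc, biprod.inr_desc_assoc,
            biprod.lift_fst, biprod.lift_snd, karoubiHomOfRetract_comp, Iso.hom_inv_id_assoc,
            biprod.inl_fst, biprod.inl_snd, biprod.inr_fst, biprod.inr_snd,
            karoubiHomOfRetract_id, karoubiHomOfRetract_zero, Category.comp_id]
      inv_hom_id := by
        rw [biprod.lift_desc, karoubiHomOfRetract_comp, karoubiHomOfRetract_comp,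
          ← karoubiHomOfRetract_add, ← karoubiHomOfRetract_id]
        congr 1
        have h : φ.inv ≫ (biprod.fst ≫ biprod.inl + biprod.snd ≫ biprod.inr) ≫ φ.hom = 𝟙 _ := by
          rw [biprod.total, Category.id_comp, φ.inv_hom_id]
        simpa only [Preadditive.add_comp, Preadditive.comp_add, Category.assoc] using h }
  exact biprod.mapIso (karoubiOfRetractIso σ).symm (Iso.refl _) ≪≫ e ≪≫ karoubiOfRetractIso τ

/-- Any choice of complements works, with no compatibility required: morphisms between retracts do
not depend on the ambient objects, up to the canonical bijections. -/
lemma exists_factorization_of_isWeaklyDense (hF : IsWeaklyDense F) :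
    ∃ G : B' ⥤ WeakIdempotentCompletion B,
      G.Additive ∧ G.Full ∧ G.Faithful ∧ Nonempty (F ⋙ G ≅ toWeakIdempotentCompletion B) := by
  choose X Y φ using hF
  let φ' : ∀ X', F.obj (X X') ⊞ X' ≅ F.obj (Y X') := fun X' => (φ X').some
  let ρ : ∀ X' : B', Retract X' (F.obj (Y X')) := fun X' =>
    ⟨biprod.inr ≫ (φ' X').hom, (φ' X').inv ≫ biprod.snd, by simp⟩
  let H : B' ⥤ Karoubi B :=
    { obj X' := karoubiOfRetract (ρ X')
      map f := karoubiHomOfRetract _ _ f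
      map_id X' := karoubiHomOfRetract_id _
      map_comp f g := (karoubiHomOfRetract_comp _ _ _ f g).symm }
  have : H.Faithful := ⟨fun h => (karoubiHomOfRetract_bijective _ _).1 h⟩
  have : H.Full := ⟨(karoubiHomOfRetract_bijective _ _).2⟩
  have : H.Additive := ⟨karoubiHomOfRetract_add _ _ _ _⟩
  let e : F ⋙ H ≅ toKaroubi B := NatIso.ofComponents
    (fun Z => karoubiOfRetractIso (ρ (F.obj Z)))
    (fun f => karoubiOfRetractIso_hom_naturality _ _ f)
  exact ⟨(isWeakRetract B).lift H fun X' => isWeakRetract_karoubiOfRetract (φ' X'),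
    ⟨fun {X' Y' f g} => by ext1; exact H.map_add⟩, inferInstance, inferInstance,
    ⟨NatIso.ofComponents (fun Z => (isWeakRetract B).isoMk (e.app Z))
      (fun f => by ext1; exact e.hom.naturality f)⟩⟩

end Factorization

/-! ### Invariance of the split Grothendieck group -/

section SplitK0

/-- The class of an object in the split Grothendieck group. -/
def SplitK0.of (X : B) : SplitK0 B :=
  QuotientAddGroup.mk (FreeAbelianGroup.of (isoClass X))

lemma SplitK0.of_eq_add {X Y Z : B} (e : Y ≅ X ⊞ Z) :
    SplitK0.of Y = SplitK0.of X + SplitK0.of Z := by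
  rw [SplitK0.of, SplitK0.of, SplitK0.of, ← QuotientAddGroup.mk_add, QuotientAddGroup.eq,
    ← neg_mem_iff]
  refine AddSubgroup.subset_closure ⟨X, Y, Z, ⟨e⟩, ?_⟩
  abel

lemma SplitK0.of_eq_of_iso {X Y : B} (e : X ≅ Y) : SplitK0.of X = SplitK0.of Y :=
  congrArg (fun x => (QuotientAddGroup.mk (FreeAbelianGroup.of x) : SplitK0 B))
    (Quotient.sound ⟨e⟩)

lemma SplitK0.of_biprod (X Y : B) : SplitK0.of (X ⊞ Y) = SplitK0.of X + SplitK0.of Y :=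
  SplitK0.of_eq_add (Iso.refl _)

lemma SplitK0.hom_ext {A : Type*} [AddCommGroup A] {f g : SplitK0 B →+ A}
    (h : ∀ X, f (SplitK0.of X) = g (SplitK0.of X)) : f = g := by
  refine QuotientAddGroup.addMonoidHom_ext _ (FreeAbelianGroup.lift_ext _ _ ?_)
  rintro ⟨X⟩
  exact h X

/-- The homomorphism from the split Grothendieck group induced by an invariant of objects
which is additive on biproducts. -/
def SplitK0.lift {A : Type*} [AddCommGroup A] (f : B → A)
    (hf : ∀ X Y, Nonempty (X ≅ Y) → f X = f Y) (hf' : ∀ X Y, f (X ⊞ Y) = f X + f Y) :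
    SplitK0 B →+ A :=
  QuotientAddGroup.lift _ (FreeAbelianGroup.lift (Quotient.lift f hf)) (by
    rw [splitRelations, AddSubgroup.closure_le]
    rintro _ ⟨X, Y, Z, e, rfl⟩
    change _ = _
    rw [map_sub, map_sub, FreeAbelianGroup.lift_apply_of, FreeAbelianGroup.lift_apply_of,
      FreeAbelianGroup.lift_apply_of]
    change f Y - f X - f Z = 0
    rw [hf _ _ e, hf']
    abel)

lemma SplitK0.lift_of {A : Type*} [AddCommGroup A] (f : B → A)
    (hf : ∀ X Y, Nonempty (X ≅ Y) → f X = f Y) (hf' : ∀ X Y, f (X ⊞ Y) = f X + f Y) (X : B) :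
    SplitK0.lift f hf hf' (SplitK0.of X) = f X :=
  FreeAbelianGroup.lift_apply_of _ _

lemma mapSplitK0_of [F.Additive] (X : B) : mapSplitK0 F (SplitK0.of X) = SplitK0.of (F.obj X) := rfl

/-- Isomorphisms `X₁ ⊞ Z ≅ Y₁` and `X₂ ⊞ Z ≅ Y₂` induce `X₁ ⊞ Y₂ ≅ X₂ ⊞ Y₁`. -/
def biprodIsoOfIsoBiprod {X₁ X₂ Y₁ Y₂ Z : B} (e₁ : X₁ ⊞ Z ≅ Y₁) (e₂ : X₂ ⊞ Z ≅ Y₂) :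
    X₁ ⊞ Y₂ ≅ X₂ ⊞ Y₁ :=
  biprod.mapIso (Iso.refl _) (e₂.symm ≪≫ biprod.braiding _ _) ≪≫ (biprod.associator _ _ _).symm ≪≫
    biprod.mapIso e₁ (Iso.refl _) ≪≫ biprod.braiding _ _

/-- The isomorphism `(W ⊞ X) ⊞ (Y ⊞ Z) ≅ (W ⊞ Y) ⊞ (X ⊞ Z)`. -/
def biprodBiprodComm (W X Y Z : B) : (W ⊞ X) ⊞ (Y ⊞ Z) ≅ (W ⊞ Y) ⊞ (X ⊞ Z) where
  hom := biprod.lift (biprod.map biprod.fst biprod.fst) (biprod.map biprod.snd biprod.snd)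
  inv := biprod.lift (biprod.map biprod.fst biprod.fst) (biprod.map biprod.snd biprod.snd)
  hom_inv_id := by ext <;> simp
  inv_hom_id := by ext <;> simp

lemma bijective_mapSplitK0_of_isWeaklyDense [F.Additive] [F.Full] [F.Faithful] (hF : IsWeaklyDense F) :
    Function.Bijective (mapSplitK0 F) := by
  -- Independence of the choice of complement: both presentations give `X₁ ⊞ Y₂ ≅ X₂ ⊞ Y₁` after
  -- applying `F`, hence already in `B`.
  have key {Z Z' : B'} {X₁ X₂ Y₁ Y₂ : B} (e : Z ≅ Z') (e₁ : F.obj X₁ ⊞ Z ≅ F.obj Y₁)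
      (e₂ : F.obj X₂ ⊞ Z' ≅ F.obj Y₂) :
      SplitK0.of Y₁ - SplitK0.of X₁ = SplitK0.of Y₂ - SplitK0.of X₂ := by
    have h := SplitK0.of_eq_of_iso (F.preimageIso (F.mapBiprod _ _ ≪≫
      biprodIsoOfIsoBiprod e₁ (biprod.mapIso (Iso.refl _) e ≪≫ e₂) ≪≫ (F.mapBiprod _ _).symm))
    rw [SplitK0.of_biprod, SplitK0.of_biprod] at h
    rw [sub_eq_sub_iff_add_eq_add, add_comm _ (SplitK0.of X₂), ← h, add_comm]
  choose X Y φ using hF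
  let g : SplitK0 B' →+ SplitK0 B := SplitK0.lift
    (fun Z => SplitK0.of (Y Z) - SplitK0.of (X Z))
    (fun Z Z' ⟨e⟩ => key e (φ Z).some (φ Z').some)
    (fun Z Z' => by
      let e : F.obj (X Z ⊞ X Z') ⊞ (Z ⊞ Z') ≅ F.obj (Y Z ⊞ Y Z') :=
        biprod.mapIso (F.mapBiprod _ _) (Iso.refl _) ≪≫ biprodBiprodComm _ _ _ _ ≪≫
          biprod.mapIso (φ Z).some (φ Z').some ≪≫ (F.mapBiprod _ _).symm
      rw [key (Iso.refl _) (φ (Z ⊞ Z')).some e, SplitK0.of_biprod, SplitK0.of_biprod]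
      abel)
  refine Function.bijective_iff_has_inverse.2 ⟨g, fun x => ?_, fun x => ?_⟩
  · refine DFunLike.congr_fun (SplitK0.hom_ext (f := g.comp (mapSplitK0 F))
      (g := AddMonoidHom.id _) fun Z => ?_) x
    change g (SplitK0.of (F.obj Z)) = SplitK0.of Z
    rw [SplitK0.lift_of, sub_eq_iff_eq_add, add_comm, ← SplitK0.of_biprod]
    exact SplitK0.of_eq_of_iso (F.preimageIso ((φ (F.obj Z)).some.symm ≪≫ (F.mapBiprod _ _).symm))
  · refine DFunLike.congr_fun (SplitK0.hom_ext (f := (mapSplitK0 F).comp g)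
      (g := AddMonoidHom.id _) fun Z => ?_) x
    change mapSplitK0 F (g (SplitK0.of Z)) = SplitK0.of Z
    rw [SplitK0.lift_of, map_sub, mapSplitK0_of, mapSplitK0_of,
      SplitK0.of_eq_add (φ Z).some.symm]
    abel

end SplitK0

attribute [local instance] hasZeroObject_of_hasFiniteBiproducts

/-! ### Contractions of two-periodic complexes -/

section Contraction

variable {C : Type u₁} [Category.{v₁} C] [Preadditive C]

variable {E O : C} {p : E ⟶ E} {dE hE : E ⟶ O} {dO hO : O ⟶ E}

/-- Write `d` and `h` for the odd operators on `E ⊕ O`. Since `h` need not square to zero, it is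
replaced by `h d h`: this is still a contraction, and it squares to zero because `d h h d = 0`. Then
`d + h d h` squares to the identity (to `p` on `E`), and its two components are `u` and `v`. -/
lemma exists_comp_eq_of_normalized_contraction
    (ddE : dE ≫ dO = 0) (ddO : dO ≫ dE = 0) (hcE : dE ≫ hO + hE ≫ dO = p)
    (hcO : dO ≫ hE + hO ≫ dE = 𝟙 O) (dOp : dO ≫ p = dO)
    (hOp : hO ≫ p = hO) :
    ∃ (u : E ⟶ O) (v : O ⟶ E), u ≫ v = p ∧ v ≫ u = 𝟙 O := by
  have hba : hE ≫ dO = p - dE ≫ hO := by rw [← hcE]; abel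
  have hcc : dO ≫ hE = 𝟙 O - hO ≫ dE := by rw [← hcO]; abel
  have hcc' : hO ≫ dE = 𝟙 O - dO ≫ hE := by rw [← hcO]; abel
  have aa : dE ≫ hO ≫ dE ≫ hO = dE ≫ hO := by
    rw [reassoc_of% hcc']
    simp [reassoc_of% ddE]
  have bb : hE ≫ dO ≫ hE ≫ dO = hE ≫ dO := by
    conv_lhs => rw [hba]
    simp [dOp, reassoc_of% ddO]
  have cc : dO ≫ hE ≫ dO ≫ hE = dO ≫ hE := by
    rw [reassoc_of% hcc]
    simp [reassoc_of% ddE]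
  have cc' : hO ≫ dE ≫ hO ≫ dE = hO ≫ dE := by
    conv_lhs => rw [hcc']
    simp [reassoc_of% ddE]
  have ab : dE ≫ hO ≫ hE ≫ dO = 0 := by
    rw [hba, Preadditive.comp_sub, Preadditive.comp_sub, hOp, aa, sub_self]
  have mid : dO ≫ hE ≫ hO ≫ dE = 0 := by
    rw [hcc', Preadditive.comp_sub, Preadditive.comp_sub, cc, Category.comp_id, sub_self]
  refine ⟨dE + hE ≫ dO ≫ hE, dO + hO ≫ dE ≫ hO, ?_, ?_⟩
  · simp only [Preadditive.add_comp, Preadditive.comp_add, Category.assoc, ddE, aa, bb,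
      reassoc_of% mid, zero_comp, comp_zero, zero_add, add_zero]
    rw [add_comm, hcE]
  · simp only [Preadditive.add_comp, Preadditive.comp_add, Category.assoc, ddO, cc, cc',
      reassoc_of% ab, zero_comp, comp_zero, zero_add, add_zero]
    rw [add_comm, hcO]

/-- A square-zero odd operator `d` on `E ⊕ O` which is contractible, up to an idempotent of `E`,
gives an isomorphism between the image of the complementary idempotent `p` and `O`. -/
lemma exists_comp_eq_of_contraction (hp : p ≫ p = p)
    (ddE : dE ≫ dO = 0) (ddO : dO ≫ dE = 0) (hcE : dE ≫ hO + hE ≫ dO = p)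
    (hcO : dO ≫ hE + hO ≫ dE = 𝟙 O) :
    ∃ (u : E ⟶ O) (v : O ⟶ E), u ≫ v = p ∧ v ≫ u = 𝟙 O := by
  have pdE : p ≫ dE = dE := by
    have hcc : hO ≫ dE = 𝟙 O - dO ≫ hE := by rw [← hcO]; abel
    simp [← hcE, hcc, ddO, reassoc_of% ddE]
  have dOp : dO ≫ p = dO := by
    have hcc : dO ≫ hE = 𝟙 O - hO ≫ dE := by rw [← hcO]; abel
    simp [← hcE, reassoc_of% hcc, reassoc_of% ddO, ddE]
  -- As `d` already factors through the image of `p`, cutting `h` down by `p` preserves the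
  -- contraction identities.
  refine exists_comp_eq_of_normalized_contraction (hE := p ≫ hE) (hO := hO ≫ p)
    ddE ddO ?_ ?_ dOp (by rw [Category.assoc, hp])
  · have h : p ≫ (dE ≫ hO + hE ≫ dO) ≫ p = p := by rw [hcE, hp, hp]
    simpa only [Preadditive.add_comp, Preadditive.comp_add, Category.assoc, reassoc_of% pdE,
      dOp] using h
  · rw [reassoc_of% dOp, Category.assoc, pdE, hcO]

end Contraction

/-! ### Folding a bounded complex into its even and odd parts -/

section ParitySums

variable {C : Type u₁} [Category.{v₁} C] [Preadditive C] [HasFiniteBiproducts C]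

lemma sum_eq_of_eq_zero {A : Type*} [AddCommMonoid A] (f : ℤ → A) (i : ℤ) (t : Finset ℤ)
    (h₁ : ∀ j, j ≠ i + 1 → j ≠ i - 1 → f j = 0) (h₂ : ∀ j ∉ t, f j = 0) :
    ∑ j : t, f j = f (i + 1) + f (i - 1) := by
  have hi : i + 1 ≠ i - 1 := by omega
  rw [Finset.sum_coe_sort t f, ← Finset.sum_pair hi]
  trans ∑ j ∈ t ∪ {i + 1, i - 1}, f j
  · exact Finset.sum_subset Finset.subset_union_left fun j _ hj => h₂ j hj
  · refine (Finset.sum_subset Finset.subset_union_right fun j _ hj => h₁ j ?_ ?_).symm <;>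
      (rintro rfl; simp at hj)

/-- The morphism between finite sums of terms of a graded object given by a matrix of
morphisms. -/
abbrev sumMatrix {X : ℤ → C} (φ : ∀ i j, X i ⟶ X j) (s t : Finset ℤ) :
    (⨁ fun i : s => X i) ⟶ ⨁ fun j : t => X j :=
  biproduct.matrix fun (i : s) (j : t) => φ i j

lemma sumMatrix_comp {X : ℤ → C} (φ ψ : ∀ i j, X i ⟶ X j) (s t u : Finset ℤ) :
    sumMatrix φ s t ≫ sumMatrix ψ t u =
      biproduct.matrix fun (i : s) (k : u) => ∑ j : t, φ i j ≫ ψ j k := by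
  ext i k
  simp [biproduct.lift_desc]

variable (M : CochainComplex C ℤ)

lemma sumMatrix_d_comp (s t u : Finset ℤ) : sumMatrix M.d s t ≫ sumMatrix M.d t u = 0 := by
  rw [sumMatrix_comp]
  ext i k
  simp

-- Entrywise this is the homotopy relation, since `d` and `H` shift degrees by `1` and `-1`. By
-- `hst`, neighbouring degrees left out of `t` carry zero objects, so truncating the sums loses
-- nothing.
variable {M} in
lemma sumMatrix_contraction {e : M ⟶ M} (H : Homotopy (𝟙 M) e) (s t : Finset ℤ)
    (hst : ∀ i ∈ s, ∀ j, (j = i + 1 ∨ j = i - 1) → j ∉ t → IsZero (M.X j)) :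
    sumMatrix M.d s t ≫ sumMatrix H.hom t s + sumMatrix H.hom s t ≫ sumMatrix M.d t s =
      𝟙 _ - biproduct.map fun i : s => e.f i := by
  rw [sumMatrix_comp, sumMatrix_comp]
  ext k i
  have hd : ∀ i j, j ≠ i + 1 → M.d i j = 0 := fun i j hij => M.shape i j (by simpa using hij.symm)
  have hH : ∀ i j, i ≠ j + 1 → H.hom i j = 0 := fun i j hij => H.zero i j (by simpa using hij.symm)
  simp only [Preadditive.add_comp, Preadditive.comp_add, biproduct.ι_matrix_assoc,
    biproduct.lift_π, ← Finset.sum_add_distrib, Preadditive.sub_comp, Preadditive.comp_sub,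
    biproduct.ι_map_assoc, Category.id_comp]
  obtain ⟨i, hi⟩ := i
  obtain ⟨k, hk⟩ := k
  have hsum := sum_eq_of_eq_zero (fun j => M.d i j ≫ H.hom j k + H.hom i j ≫ M.d j k) i t
    (fun j h₁ h₂ => by simp only [hd i j h₁, hH i j (by omega), zero_comp, add_zero])
    (fun j hj => by
      by_cases hj' : j = i + 1 ∨ j = i - 1
      · have hz := hst i hi j hj' hj
        rw [hz.eq_of_tgt (M.d i j) 0, hz.eq_of_tgt (H.hom i j) 0, zero_comp, zero_comp, add_zero]
      · push Not at hj'
        simp only [hd i j hj'.1, hH i j (by omega), zero_comp, add_zero])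
  refine hsum.trans ?_
  have hz₁ : H.hom i (i + 1) = 0 := hH _ _ (by omega)
  have hz₂ : M.d i (i - 1) = 0 := hd _ _ (by omega)
  dsimp only
  rw [hz₁, hz₂, zero_comp, zero_comp, add_zero, zero_add]
  by_cases hik : i = k
  · subst hik
    have hc := H.comm i
    rw [dNext_eq _ (show (ComplexShape.up ℤ).Rel i (i + 1) by simp),
      prevD_eq _ (show (ComplexShape.up ℤ).Rel (i - 1) i by simp), HomologicalComplex.id_f] at hc
    rw [biproduct.ι_π_self, Category.comp_id]
    exact eq_sub_of_add_eq hc.symm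
  · rw [hH (i + 1) k (by omega), hd (i - 1) k (by omega), comp_zero, comp_zero, add_zero,
      biproduct.ι_π_ne _ (by simpa using hik), comp_zero, sub_zero]

/-- If the identity of a bounded complex `M` is homotopic to an idempotent `e` concentrated in
degree zero, then the sum of the odd terms of `M` is a complement of the image of `e` in the sum
of the even terms of `M`. -/
lemma exists_of_homotopy_id (hM : ∃ a b : ℤ, ∀ i : ℤ, (i < a ∨ b < i) → IsZero (M.X i))
    {e : M ⟶ M} (he : e ≫ e = e) (he₀ : ∀ i, i ≠ 0 → e.f i = 0) (H : Homotopy (𝟙 M) e) :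
    ∃ (E O : C) (r : Retract (M.X 0) E) (u : E ⟶ O) (v : O ⟶ E),
      u ≫ v = 𝟙 E - r.r ≫ e.f 0 ≫ r.i ∧ v ≫ u = 𝟙 O := by
  obtain ⟨a, b, hM⟩ := hM
  -- The interval is enlarged to contain `0`, so that `M.X 0` is always a summand of the even part.
  let I : Finset ℤ := Finset.Icc (min a 0) (max b 0)
  have hI : ∀ i ∉ I, IsZero (M.X i) := fun i hi => hM i (by
    simp only [I, Finset.mem_Icc] at hi
    omega)
  let s : Finset ℤ := I.filter Even
  let t : Finset ℤ := I.filter Odd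
  let z : s := ⟨0, by simp [s, I]⟩
  have hst : ∀ i ∈ s, ∀ j, (j = i + 1 ∨ j = i - 1) → j ∉ t → IsZero (M.X j) := by
    intro i hi j hj hjt
    refine hI j fun hjI => hjt (Finset.mem_filter.2 ⟨hjI, ?_⟩)
    obtain rfl | rfl := hj
    · exact (Finset.mem_filter.1 hi).2.add_one
    · exact (Finset.mem_filter.1 hi).2.sub_odd odd_one
  have hts : ∀ i ∈ t, ∀ j, (j = i + 1 ∨ j = i - 1) → j ∉ s → IsZero (M.X j) := by
    intro i hi j hj hjs
    refine hI j fun hjI => hjs (Finset.mem_filter.2 ⟨hjI, ?_⟩)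
    obtain rfl | rfl := hj
    · exact (Finset.mem_filter.1 hi).2.add_one
    · exact (Finset.mem_filter.1 hi).2.sub_odd odd_one
  have het : biproduct.map (fun i : t => e.f i) = 0 := by
    ext i k
    rw [biproduct.ι_map_assoc, he₀ k.1, zero_comp, zero_comp, comp_zero]
    intro hi
    have := (Finset.mem_filter.1 k.2).2
    rw [hi] at this
    exact absurd this (by decide)
  have hes : biproduct.map (fun i : s => e.f i) =
      biproduct.π (fun i : s => M.X i) z ≫ e.f 0 ≫ biproduct.ι (fun i : s => M.X i) z := by
    rw [biproduct.map_eq, Finset.sum_eq_single z]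
    · intro i _ hi
      rw [he₀ i.1 (fun h => hi (Subtype.ext h)), zero_comp, comp_zero]
    · simp
  have hee : biproduct.map (fun i : s => e.f i) ≫ biproduct.map (fun i : s => e.f i) =
      biproduct.map (fun i : s => e.f i) := by
    have h : ∀ i, e.f i ≫ e.f i = e.f i := fun i => by rw [← HomologicalComplex.comp_f, he]
    ext i k
    simp [h i.1]
  obtain ⟨u, v, huv, hvu⟩ := exists_comp_eq_of_contraction
    (p := 𝟙 _ - biproduct.map fun i : s => e.f i)
    (by simp [Preadditive.sub_comp, Preadditive.comp_sub, hee])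
    (sumMatrix_d_comp M s t s) (sumMatrix_d_comp M t s t) (sumMatrix_contraction H s t hst)
    (by rw [sumMatrix_contraction H t s hts, het, sub_zero])
  exact ⟨_, _, ⟨biproduct.ι (fun i : s => M.X i) z, biproduct.π (fun i : s => M.X i) z,
    biproduct.ι_π_self _ _⟩, u, v, by rw [huv, hes], hvu⟩

end ParitySums

/-! ### Equivalence of bounded homotopy categories and weak density -/

section BoundedComplexes

variable [F.Additive]

-- Choosing zero objects for zero terms keeps the complex built from these choices bounded.
variable {F} in
lemma exists_of_isZero (hF : IsWeaklyDense F) (X' : B') :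
    ∃ X Y : B, Nonempty (F.obj X ⊞ X' ≅ F.obj Y) ∧ (IsZero X' → IsZero X ∧ IsZero Y) := by
  by_cases h : IsZero X'
  · obtain ⟨Z, hZ⟩ := HasZeroObject.zero (C := B)
    have hFZ : IsZero (F.obj Z) := F.map_isZero hZ
    exact ⟨Z, Z, ⟨(biprod_isZero_iff _ _).2 ⟨hFZ, h⟩ |>.iso hFZ⟩, fun _ => ⟨hZ, hZ⟩⟩
  · obtain ⟨X, Y, φ⟩ := hF X'
    exact ⟨X, Y, φ, fun h' => absurd h' h⟩

variable [F.Full] [F.Faithful]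

instance : (mapBoundedHomotopyCategory F).Full := by
  unfold mapBoundedHomotopyCategory
  infer_instance

instance : (mapBoundedHomotopyCategory F).Faithful := by
  unfold mapBoundedHomotopyCategory
  infer_instance

/-- Homotopic endomorphisms of a complex concentrated in one degree are equal. -/
lemma eq_of_homotopy_single {X : B'} {n : ℤ}
    {f g : (HomologicalComplex.single B' (ComplexShape.up ℤ) n).obj X ⟶
      (HomologicalComplex.single B' (ComplexShape.up ℤ) n).obj X} (H : Homotopy f g) : f = g := by
  refine HomologicalComplex.hom_ext _ _ fun i => ?_
  have h := H.comm i
  rw [dNext_eq _ (show (ComplexShape.up ℤ).Rel i (i + 1) by simp),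
    prevD_eq _ (show (ComplexShape.up ℤ).Rel (i - 1) i by simp)] at h
  simpa using h

variable {F} in
lemma isWeaklyDense_of_homotopyEquiv {M : CochainComplex B ℤ}
    (hM : ∃ a b : ℤ, ∀ i : ℤ, (i < a ∨ b < i) → IsZero (M.X i)) {X' : B'}
    (E : HomotopyEquiv ((F.mapHomologicalComplex (ComplexShape.up ℤ)).obj M)
      ((HomologicalComplex.single B' (ComplexShape.up ℤ) 0).obj X')) :
    ∃ X Y : B, Nonempty (F.obj X ⊞ X' ≅ F.obj Y) := by
  -- Equality on the nose, not just up to homotopy, is what makes `E.hom ≫ E.inv` a strict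
  -- idempotent.
  have hgf : E.inv ≫ E.hom = 𝟙 _ := eq_of_homotopy_single E.homotopyInvHomId
  obtain ⟨e, he⟩ := (F.mapHomologicalComplex (ComplexShape.up ℤ)).map_surjective (E.hom ≫ E.inv)
  have hee : e ≫ e = e := by
    apply (F.mapHomologicalComplex (ComplexShape.up ℤ)).map_injective
    rw [Functor.map_comp, he, Category.assoc, reassoc_of% hgf]
  let S := (HomologicalComplex.single B' (ComplexShape.up ℤ) 0).obj X'
  let φ (i : ℤ) : F.obj (M.X i) ⟶ S.X i := E.hom.f i
  let ψ (i : ℤ) : S.X i ⟶ F.obj (M.X i) := E.inv.f i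
  have hef (i : ℤ) : F.map (e.f i) = φ i ≫ ψ i :=
    congrArg (fun φ => HomologicalComplex.Hom.f φ i) he
  have he₀ (i : ℤ) (hi : i ≠ 0) : e.f i = 0 := by
    apply F.map_injective
    have h : φ i = 0 :=
      (HomologicalComplex.isZero_single_obj_X (ComplexShape.up ℤ) 0 X' i hi).eq_of_tgt _ _
    rw [hef, h, zero_comp, F.map_zero]
  have H : Homotopy (𝟙 M) e := F.preimageHomotopy (by
    rw [he, CategoryTheory.Functor.map_id]
    exact E.homotopyHomInvId.symm)
  obtain ⟨Y, X, r, u, v, huv, hvu⟩ := exists_of_homotopy_id M hM hee he₀ H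
  let σ : S.X 0 ≅ X' := HomologicalComplex.singleObjXSelf (ComplexShape.up ℤ) 0 X'
  let f : F.obj (M.X 0) ⟶ X' := φ 0 ≫ σ.hom
  let g : X' ⟶ F.obj (M.X 0) := σ.inv ≫ ψ 0
  have hgf₀ : g ≫ f = 𝟙 X' := by
    have h : ψ 0 ≫ φ 0 = 𝟙 _ := congrArg (fun φ => HomologicalComplex.Hom.f φ 0) hgf
    simp [f, g, reassoc_of% h]
  have hfg : f ≫ g = F.map (e.f 0) := by simp [f, g, hef]
  have hr : F.map r.i ≫ F.map r.r = 𝟙 _ := by rw [← F.map_comp, r.retract, F.map_id]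
  have huv' : F.map u ≫ F.map v + (F.map r.r ≫ f) ≫ g ≫ F.map r.i = 𝟙 _ := by
    rw [← F.map_comp, huv, Category.assoc, reassoc_of% hfg, F.map_sub, F.map_comp, F.map_comp,
      F.map_id, sub_add_cancel]
  have hvu' : F.map v ≫ F.map u = 𝟙 _ := by rw [← F.map_comp, hvu, F.map_id]
  have hg : (g ≫ F.map r.i) ≫ F.map r.r ≫ f = 𝟙 _ := by
    rw [Category.assoc, reassoc_of% hr, hgf₀]
  -- Inserting the decomposition `huv'` of the identity gives `x = x + x` for the morphism `x` in
  -- question; the same argument proves `hgu`.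
  have hvf : F.map v ≫ F.map r.r ≫ f = 0 := by
    have h := F.map v ≫= huv' =≫ (F.map r.r ≫ f)
    simpa [reassoc_of% hvu', reassoc_of% hr, hgf₀] using h
  have hgu : (g ≫ F.map r.i) ≫ F.map u = 0 := by
    have h := (g ≫ F.map r.i) ≫= huv' =≫ F.map u
    simpa [hvu', reassoc_of% hr, reassoc_of% hgf₀] using h
  exact ⟨X, Y, ⟨
    { hom := biprod.desc (F.map v) (g ≫ F.map r.i)
      inv := biprod.lift (F.map u) (F.map r.r ≫ f)
      hom_inv_id := by
        apply biprod.hom_ext' <;> apply biprod.hom_ext <;>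
          simp only [Category.assoc, biprod.inl_desc_assoc, biprod.inr_desc_assoc,
            biprod.lift_fst, biprod.lift_snd, Category.comp_id, biprod.inl_fst, biprod.inl_snd,
            biprod.inr_fst, biprod.inr_snd]
        · exact hvu'
        · exact hvf
        · simpa using hgu
        · simpa using hg
      inv_hom_id := by rw [biprod.lift_desc, huv'] }⟩⟩

lemma isWeaklyDense_of_isEquivalence [(mapBoundedHomotopyCategory F).IsEquivalence] :
    IsWeaklyDense F := by
  intro X'
  let K : BoundedHomotopyCategory B' :=
    ⟨(HomotopyCategory.quotient B' (ComplexShape.up ℤ)).obj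
      ((HomologicalComplex.single B' (ComplexShape.up ℤ) 0).obj X'), 0, 0, fun i hi =>
        HomologicalComplex.isZero_single_obj_X (ComplexShape.up ℤ) 0 X' i (by omega)⟩
  let e := (bounded B').ι.mapIso ((mapBoundedHomotopyCategory F).objObjPreimageIso K)
  exact isWeaklyDense_of_homotopyEquiv
    ((mapBoundedHomotopyCategory F).objPreimage K).property (HomotopyCategory.homotopyEquivOfIso e)

/-- Adding a contractible complex to a complex does not change its isomorphism class in the
homotopy category. -/
def quotientBiprodIso (K L : CochainComplex B' ℤ)
    (hL : IsZero ((HomotopyCategory.quotient B' (ComplexShape.up ℤ)).obj L)) :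
    (HomotopyCategory.quotient B' (ComplexShape.up ℤ)).obj (K ⊞ L) ≅
      (HomotopyCategory.quotient B' (ComplexShape.up ℤ)).obj K where
  hom := (HomotopyCategory.quotient B' (ComplexShape.up ℤ)).map biprod.fst
  inv := (HomotopyCategory.quotient B' (ComplexShape.up ℤ)).map biprod.inl
  hom_inv_id := by
    have h := congrArg (HomotopyCategory.quotient B' (ComplexShape.up ℤ)).map
      (biprod.total (X := K) (Y := L))
    rw [Functor.map_add, Functor.map_comp, Functor.map_comp, CategoryTheory.Functor.map_id] at h
    rw [← h, hL.eq_of_src ((HomotopyCategory.quotient B' (ComplexShape.up ℤ)).map biprod.inr) 0,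
      comp_zero, add_zero]
  inv_hom_id := by rw [← Functor.map_comp, biprod.inl_fst, CategoryTheory.Functor.map_id]

variable {F} in
/-- A complex with terms in the essential image of a fully faithful functor comes from the
source. -/
def liftComplex (L : CochainComplex B' ℤ) {X : ℤ → B} (φ : ∀ i, L.X i ≅ F.obj (X i)) :
    CochainComplex B ℤ where
  X := X
  d i j := F.preimage ((φ i).inv ≫ L.d i j ≫ (φ j).hom)
  shape i j hij := F.map_injective (by simp [L.shape i j hij])
  d_comp_d' i j k _ _ := F.map_injective (by simp)

variable {F} in
/-- The complex lifted along `F` is isomorphic to the original one. -/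
def mapLiftComplexIso (L : CochainComplex B' ℤ) {X : ℤ → B} (φ : ∀ i, L.X i ≅ F.obj (X i)) :
    (F.mapHomologicalComplex (ComplexShape.up ℤ)).obj (liftComplex L φ) ≅ L :=
  HomologicalComplex.Hom.isoOfComponents (fun i => (φ i).symm) (fun i j _ => by
    change (φ i).inv ≫ L.d i j = F.map (F.preimage _) ≫ (φ j).inv
    simp)

lemma essSurj_mapBoundedHomotopyCategory (hF : IsWeaklyDense F) :
    (mapBoundedHomotopyCategory F).EssSurj := by
  refine ⟨fun ⟨K, a, b, hK⟩ => ?_⟩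
  obtain ⟨K, rfl⟩ := HomotopyCategory.quotient_obj_surjective K
  choose X Y φ hXY using fun i => exists_of_isZero hF (K.X i)
  -- The cone of `𝟙 A` is contractible with degree `i` term `F X (i + 1) ⊞ F X i`; the summand `F X
  -- i` completes `K.X i` to `F Y i`.
  let A : CochainComplex B' ℤ := { X := fun i => F.obj (X i), d := fun _ _ => 0 }
  let L := CochainComplex.mappingCone (𝟙 A)
  have hL : IsZero ((HomotopyCategory.quotient B' (ComplexShape.up ℤ)).obj L) :=
    (HomotopyCategory.isZero_quotient_obj_iff _).2
      ⟨CochainComplex.mappingCone.homotopyToZeroOfId A⟩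
  let ψ (i : ℤ) : (K ⊞ L).X i ≅ F.obj (X (i + 1) ⊞ Y i) :=
    HomologicalComplex.biprodXIso K L i ≪≫
      biprod.mapIso (Iso.refl _)
        (HomologicalComplex.homotopyCofiber.XIsoBiprod (𝟙 A) i (i + 1) (by simp)) ≪≫
      biprod.braiding _ _ ≪≫ biprod.associator _ _ _ ≪≫
      biprod.mapIso (Iso.refl _) (φ i).some ≪≫ (F.mapBiprod _ _).symm
  -- The lower bound drops to `a - 1` because `X (i + 1)` sits in degree `i`.
  refine ⟨⟨(HomotopyCategory.quotient B _).obj (liftComplex (K ⊞ L) ψ), a - 1, b, fun i hi => ?_⟩,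
    ⟨(bounded B').isoMk ((HomotopyCategory.quotient B' _).mapIso (mapLiftComplexIso (K ⊞ L) ψ) ≪≫
      quotientBiprodIso K L hL)⟩⟩
  exact (biprod_isZero_iff _ _).2 ⟨(hXY (i + 1) (hK _ (by omega))).1, (hXY i (hK i (by omega))).2⟩

lemma isEquivalence_mapBoundedHomotopyCategory_iff :
    (mapBoundedHomotopyCategory F).IsEquivalence ↔ IsWeaklyDense F :=
  ⟨fun _ => isWeaklyDense_of_isEquivalence F, fun hF =>
    { essSurj := essSurj_mapBoundedHomotopyCategory F hF }⟩

end BoundedComplexes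

end WeakIdem

end

theorem corollary4p3
    {B : Type u₁} [Category.{v₁} B] [Preadditive B] [HasFiniteBiproducts B]
    {B' : Type u₂} [Category.{v₂} B'] [Preadditive B'] [HasFiniteBiproducts B']
    (F : B ⥤ B') [F.Additive] [F.Full] [F.Faithful] :
    ((mapBoundedHomotopyCategory F).IsEquivalence ↔
      ∃ G : B' ⥤ WeakIdempotentCompletion B,
        G.Additive ∧ G.Full ∧ G.Faithful ∧ Nonempty (F ⋙ G ≅ toWeakIdempotentCompletion B)) ∧
    (EssentiallySmall.{w} B' →
      (∃ G : B' ⥤ WeakIdempotentCompletion B,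
        G.Additive ∧ G.Full ∧ G.Faithful ∧ Nonempty (F ⋙ G ≅ toWeakIdempotentCompletion B)) →
      Function.Bijective (mapSplitK0 F)) := by
  have h : IsWeaklyDense F ↔ ∃ G : B' ⥤ WeakIdempotentCompletion B,
      G.Additive ∧ G.Full ∧ G.Faithful ∧ Nonempty (F ⋙ G ≅ toWeakIdempotentCompletion B) :=
    ⟨exists_factorization_of_isWeaklyDense F, fun ⟨G, hG, _, _, ⟨e⟩⟩ =>
      isWeaklyDense_of_factorization G hG e⟩
  exact ⟨(isEquivalence_mapBoundedHomotopyCategory_iff F).trans h, fun _ hG =>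
    bijective_mapSplitK0_of_isWeaklyDense F (h.2 hG)⟩
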